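/- Let $X\subset\mathbb{R}^2$ be a non-empty arc-connected (i.e. path-connected) compact set that is not an axis-aligned rectangle $[a,b]\times[c,d]$ with $a\le b$, $c\le d$ (degenerate rectangles, that is, points and horizontal or vertical segments, count as rectangles), and let $k\ge 1$ be an integer. Then there is a finite family $\mathcal{F}$ of subsets of the plane, each obtained from $X$ by translation and independent horizontal and vertical scaling with positive factors, i.e. each of the form $\{(sx+a,\;ty+b) : (x,y)\in X\}$ with $s,t>0$ and $a,b\in\mathbb{R}$, such that the intersection graph of $\mathcal{F}$ (whose vertices are the members of $\mathcal{F}$, two distinct members being adjacent if and only if they intersect) is triangle-free and has chromatic number $\chi(\mathcal{F})>k$. -/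

import Mathlib

/-- An axis-aligned rectangle in the plane: a product of two non-empty compact intervals.
Degenerate rectangles (points and horizontal or vertical segments) are included. -/
def IsAxisAlignedRectangle (X : Set (ℝ × ℝ)) : Prop :=
  ∃ a b c d : ℝ, a ≤ b ∧ c ≤ d ∧ X = Set.Icc a b ×ˢ Set.Icc c d

/-- `Y` is obtained from `X` by translation and independent horizontal and vertical scaling,
with positive scale factors. -/
def IsTransformedCopy (X Y : Set (ℝ × ℝ)) : Prop :=
  ∃ s t a b : ℝ, 0 < s ∧ 0 < t ∧ Y = (fun p : ℝ × ℝ => (s * p.1 + a, t * p.2 + b)) '' X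

/-- The intersection graph of a family of sets: the vertices are the members of the family, and
two distinct members are adjacent when they have a common point. -/
def intersectionGraph {α : Type*} (F : Set (Set α)) : SimpleGraph F where
  Adj A B := A ≠ B ∧ ((A : Set α) ∩ (B : Set α)).Nonempty
  symm := ⟨fun A B h => ⟨h.1.symm, by rw [Set.inter_comm]; exact h.2⟩⟩
  loopless := ⟨fun A h => h.1 rfl⟩

/-! A compact path-connected `X` that is not a rectangle misses a small rectangle of its bounding
box, a hole. A path of `X` from bottom to top passes this hole on one side; after a reflection, on
the right. Copies of `X` are placed recursively together with probes: rectangles (roots) free of the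
family, such that every member meeting the beam, the strip extending the root to the right, crosses
it vertically, and these members are pairwise disjoint. The invariant `Forces` says that every
proper colouring shows at least k colours on some probe.

To gain a colour, a second family forcing k colours is put inside each root, in its left part, and
each probe of the second family receives a diagonal: a stretched copy of `X` in the upper half of
its beam. The diagonal meets every member crossing that probe (`exists_eq_of_paths_cross`), and as
these are pairwise disjoint, no triangle arises. Let S be the set of at least k colours shown on the
outer probe, and take an inner probe showing at least k colours. If these and S together make at
most k colours, they coincide with S, so the diagonal has a colour outside S, visible alone from its
hole; otherwise the lower part of the inner probe already suffices (`Forces.addDiagonals`). The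
members crossing the outer beam also cross the inner probes, so k + 1 colours appear on one probe
(`Forces.compose`). -/

open Set

/-! ### Planar topology: crossing paths meet. -/

/-- A continuous angle along which the cosine stays nonnegative cannot leave `[-π/2, π/2]`. -/
theorem abs_le_pi_div_two_of_cos_nonneg {h : ℝ → ℝ} {a b : ℝ} (hc : Continuous h)
    (hcos : ∀ t ∈ uIcc a b, 0 ≤ Real.cos (h t)) (ha : |h a| ≤ Real.pi / 2) :
    |h b| ≤ Real.pi / 2 := by
  have hpi := Real.pi_pos
  rw [abs_le] at ha ⊢
  by_contra hb
  have hivt := intermediate_value_uIcc (hc.continuousOn (s := uIcc a b))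
  rcases lt_or_ge (h b) (-(Real.pi / 2)) with h1 | h1
  -- Capping the overshoot at distance π from 0 yields an attained value at which the cosine is
  -- negative.
  · obtain ⟨t, ht, hv⟩ := hivt
      (show max (h b) (-Real.pi) ∈ uIcc (h a) (h b) by
        rw [uIcc_of_ge (by linarith)]
        exact ⟨le_max_left _ _, max_le (by linarith) (by linarith)⟩)
    have h2 := hcos t ht
    rw [hv, ← Real.cos_neg] at h2
    refine absurd h2 (not_le.2 (Real.cos_neg_of_pi_div_two_lt_of_lt ?_ ?_))
    · rw [lt_neg]; exact max_lt (by linarith) (by linarith)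
    · have := le_max_right (h b) (-Real.pi); linarith
  · have h3 : Real.pi / 2 < h b := by
      by_contra h3
      exact hb ⟨h1, not_lt.1 h3⟩
    obtain ⟨t, ht, hv⟩ := hivt
      (show min (h b) Real.pi ∈ uIcc (h a) (h b) by
        rw [uIcc_of_le (by linarith)]
        exact ⟨le_min (by linarith) (by linarith), min_le_left _ _⟩)
    have h2 := hcos t ht
    rw [hv] at h2
    refine absurd h2 (not_le.2 (Real.cos_neg_of_pi_div_two_lt_of_lt ?_ ?_))
    · exact lt_min h3 (by linarith)
    · have := min_le_right (h b) Real.pi; linarith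

/-- A nowhere vanishing continuous map from a rectangle to the complex plane cannot send the four
sides, in cyclic order, into the four closed half-planes bounded by the axes. -/
theorem exists_eq_zero_of_sides_in_halfplanes {f : ℝ × ℝ → ℂ} (hf : Continuous f) {a b c d : ℝ}
    (hab : a ≤ b) (hcd : c ≤ d)
    (hleft : ∀ t ∈ Icc c d, (f (a, t)).re ≤ 0) (hright : ∀ t ∈ Icc c d, 0 ≤ (f (b, t)).re)
    (hbot : ∀ s ∈ Icc a b, 0 ≤ (f (s, c)).im) (htop : ∀ s ∈ Icc a b, (f (s, d)).im ≤ 0) :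
    ∃ z, f z = 0 := by
  by_contra! hne
  have hpi := Real.pi_pos
  -- The plane is simply connected, so a map avoiding 0 lifts through `exp`; the imaginary part of
  -- the lift is a global continuous angle.
  obtain ⟨g, ⟨hg0, hg⟩, -⟩ := Complex.isCoveringMapOn_exp.existsUnique_continuousMap_lifts
    ⟨f, hf⟩ (a₀ := (a, c)) (Complex.exp_log (hne (a, c))) hne
  have hexp : ∀ z, Complex.exp (g z) = f z := fun z => congrFun hg z
  have hgc : Continuous fun z => (g z).im := Complex.continuous_im.comp g.continuous
  set θ : ℝ × ℝ → ℝ := fun z => (g z).im with hθ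
  have hre : ∀ z, (f z).re = Real.exp (g z).re * Real.cos (θ z) := fun z => by
    rw [← hexp, Complex.exp_re]
  have him : ∀ z, (f z).im = Real.exp (g z).re * Real.sin (θ z) := fun z => by
    rw [← hexp, Complex.exp_im]
  have cos_nonneg : ∀ z, 0 ≤ (f z).re → 0 ≤ Real.cos (θ z) := fun z hz => by
    rw [hre] at hz; exact nonneg_of_mul_nonneg_right hz (Real.exp_pos _)
  have cos_nonpos : ∀ z, (f z).re ≤ 0 → Real.cos (θ z) ≤ 0 := fun z hz => by
    rw [hre] at hz; exact nonpos_of_mul_nonpos_right hz (Real.exp_pos _)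
  have sin_nonneg : ∀ z, 0 ≤ (f z).im → 0 ≤ Real.sin (θ z) := fun z hz => by
    rw [him] at hz; exact nonneg_of_mul_nonneg_right hz (Real.exp_pos _)
  have sin_nonpos : ∀ z, (f z).im ≤ 0 → Real.sin (θ z) ≤ 0 := fun z hz => by
    rw [him] at hz; exact nonpos_of_mul_nonpos_right hz (Real.exp_pos _)
  have ma : a ∈ Icc a b := ⟨le_rfl, hab⟩
  have mb : b ∈ Icc a b := ⟨hab, le_rfl⟩
  have mc : c ∈ Icc c d := ⟨le_rfl, hcd⟩
  have md : d ∈ Icc c d := ⟨hcd, le_rfl⟩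
  have h0 : θ (a, c) = Complex.arg (f (a, c)) := by
    simp only [hθ]; rw [hg0, Complex.log_im]; rfl
  have h1 : 0 ≤ θ (a, c) := by rw [h0]; exact Complex.arg_nonneg_iff.2 (hbot a ma)
  have h2 : θ (a, c) ≤ Real.pi := by rw [h0]; exact Complex.arg_le_pi _
  have h3 : Real.pi / 2 ≤ θ (a, c) := by
    by_contra! h
    exact absurd (cos_nonpos _ (hleft c mc))
      (not_le.2 (Real.cos_pos_of_mem_Ioo ⟨by linarith, h⟩))
  -- The corner `(a, c)` has angle in [π/2, π]. Following the left, top and right sides gives at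
  -- least 3π/2 at `(b, c)`, while the bottom side gives at most π.
  have h4 := abs_le.1 <| abs_le_pi_div_two_of_cos_nonneg (h := fun t => θ (a, t) - Real.pi)
    (a := c) (b := d) (by fun_prop)
    (fun t ht => by
      rw [uIcc_of_le hcd] at ht
      rw [Real.cos_sub_pi]
      linarith [cos_nonpos _ (hleft t ht)])
    (abs_le.2 ⟨by linarith, by linarith⟩)
  have h5 : Real.pi ≤ θ (a, d) := by
    by_contra! h
    exact absurd (sin_nonpos _ (htop a ma))
      (not_le.2 (Real.sin_pos_of_mem_Ioo ⟨by linarith [h4.1], h⟩))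
  have h6 := abs_le.1 <| abs_le_pi_div_two_of_cos_nonneg
    (h := fun s => θ (s, d) - Real.pi - Real.pi / 2) (a := a) (b := b) (by fun_prop)
    (fun s hs => by
      rw [uIcc_of_le hab] at hs
      rw [Real.cos_sub_pi_div_two, Real.sin_sub_pi]
      linarith [sin_nonpos _ (htop s hs)])
    (abs_le.2 ⟨by linarith, by linarith⟩)
  have h7 : Real.pi / 2 ≤ θ (b, d) - Real.pi := by
    by_contra! h
    have := Real.cos_pos_of_mem_Ioo (x := θ (b, d) - Real.pi) ⟨by linarith [h6.1], h⟩
    rw [Real.cos_sub_pi] at this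
    linarith [cos_nonneg _ (hright d md)]
  have h8 := abs_le.1 <| abs_le_pi_div_two_of_cos_nonneg
    (h := fun t => θ (b, t) - 2 * Real.pi) (a := d) (b := c) (by fun_prop)
    (fun t ht => by
      rw [uIcc_of_ge hcd] at ht
      rw [Real.cos_sub_two_pi]
      exact cos_nonneg _ (hright t ht))
    (abs_le.2 ⟨by linarith, by linarith⟩)
  have h9 := abs_le.1 <| abs_le_pi_div_two_of_cos_nonneg
    (h := fun s => θ (s, c) - Real.pi / 2) (a := a) (b := b) (by fun_prop)
    (fun s hs => by
      rw [uIcc_of_le hab] at hs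
      rw [Real.cos_sub_pi_div_two]
      exact sin_nonneg _ (hbot s hs))
    (abs_le.2 ⟨by linarith, by linarith⟩)
  linarith [h8.1, h9.2]

/-- A path from left to right and a path from bottom to top of a common box meet. -/
theorem exists_eq_of_paths_cross {γ δ : ℝ → ℝ × ℝ} {a b c d : ℝ} (hab : a ≤ b) (hcd : c ≤ d)
    (hγ : ContinuousOn γ (Icc a b)) (hδ : ContinuousOn δ (Icc c d))
    (hleft : ∀ t ∈ Icc c d, (γ a).1 ≤ (δ t).1) (hright : ∀ t ∈ Icc c d, (δ t).1 ≤ (γ b).1)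
    (hbot : ∀ s ∈ Icc a b, (δ c).2 ≤ (γ s).2) (htop : ∀ s ∈ Icc a b, (γ s).2 ≤ (δ d).2) :
    ∃ s ∈ Icc a b, ∃ t ∈ Icc c d, γ s = δ t := by
  -- Constant extension past the endpoints makes the difference of the paths continuous on the whole
  -- plane. A zero outside the parameter rectangle is harmless: clamping its coordinates keeps the
  -- values.
  set γ' := IccExtend hab ((Icc a b).domRestrict γ) with hγ'
  set δ' := IccExtend hcd ((Icc c d).domRestrict δ) with hδ'
  have cγ : Continuous γ' := (continuousOn_iff_continuous_domRestrict.1 hγ).Icc_extend'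
  have cδ : Continuous δ' := (continuousOn_iff_continuous_domRestrict.1 hδ).Icc_extend'
  have eγ : ∀ s ∈ Icc a b, γ' s = γ s := fun s hs => IccExtend_of_mem _ _ hs
  have eδ : ∀ t ∈ Icc c d, δ' t = δ t := fun t ht => IccExtend_of_mem _ _ ht
  obtain ⟨⟨s, t⟩, hz⟩ := exists_eq_zero_of_sides_in_halfplanes
    (f := fun z => ⟨(γ' z.1).1 - (δ' z.2).1, (γ' z.1).2 - (δ' z.2).2⟩)
    (by
      have e : (fun z : ℝ × ℝ =>
        (⟨(γ' z.1).1 - (δ' z.2).1, (γ' z.1).2 - (δ' z.2).2⟩ : ℂ)) =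
        fun z => Complex.equivRealProdCLM.symm
          ((γ' z.1).1 - (δ' z.2).1, (γ' z.1).2 - (δ' z.2).2) := by
        funext z; rfl
      rw [e]; fun_prop)
    hab hcd
    (fun t ht => by
      simp only [eγ a ⟨le_rfl, hab⟩, eδ t ht]; linarith [hleft t ht])
    (fun t ht => by
      simp only [eγ b ⟨hab, le_rfl⟩, eδ t ht]; linarith [hright t ht])
    (fun s hs => by
      simp only [eδ c ⟨le_rfl, hcd⟩, eγ s hs]; linarith [hbot s hs])
    (fun s hs => by
      simp only [eδ d ⟨hcd, le_rfl⟩, eγ s hs]; linarith [htop s hs])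
  have h1 := congrArg Complex.re hz
  have h2 := congrArg Complex.im hz
  simp only [Complex.zero_re, Complex.zero_im] at h1 h2
  refine ⟨projIcc a b hab s, (projIcc a b hab s).2, projIcc c d hcd t, (projIcc c d hcd t).2, ?_⟩
  exact Prod.ext (sub_eq_zero.1 h1) (sub_eq_zero.1 h2)

/-- A continuous function rising through `[u, v]` has a stretch that rises from `u` to `v`
inside `[u, v]`. -/
theorem exists_stretch {f : ℝ → ℝ} {a b u v : ℝ} (hab : a ≤ b) (huv : u ≤ v)
    (hf : ContinuousOn f (Icc a b)) (ha : f a ≤ u) (hb : v ≤ f b) :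
    ∃ s t, a ≤ s ∧ s ≤ t ∧ t ≤ b ∧ f s = u ∧ f t = v ∧ ∀ r ∈ Icc s t, f r ∈ Icc u v := by
  -- Take `t` as the first time at height `v`, then `s` as the last time before `t` at height `u`;
  -- leaving `[u, v]` in between would contradict one of these choices.
  obtain ⟨t, ⟨⟨hat, htb⟩, ht⟩, htmin⟩ : ∃ t, IsLeast (Icc a b ∩ f ⁻¹' {v}) t := by
    refine IsCompact.exists_isLeast ?_ ?_
    · exact isCompact_Icc.of_isClosed_subset
        (hf.preimage_isClosed_of_isClosed isClosed_Icc isClosed_singleton) inter_subset_left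
    · obtain ⟨t, ht, e⟩ := intermediate_value_Icc hab hf ⟨ha.trans huv, hb⟩
      exact ⟨t, ht, e⟩
  have ht : f t = v := ht
  have hf' : ContinuousOn f (Icc a t) := hf.mono (Icc_subset_Icc_right htb)
  obtain ⟨s, ⟨⟨has, hst⟩, hs⟩, hsmax⟩ : ∃ s, IsGreatest (Icc a t ∩ f ⁻¹' {u}) s := by
    refine IsCompact.exists_isGreatest ?_ ?_
    · exact isCompact_Icc.of_isClosed_subset
        (hf'.preimage_isClosed_of_isClosed isClosed_Icc isClosed_singleton) inter_subset_left
    · obtain ⟨s, hs, e⟩ := intermediate_value_Icc hat hf' ⟨ha, huv.trans ht.ge⟩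
      exact ⟨s, hs, e⟩
  have hs : f s = u := hs
  refine ⟨s, t, has, hst, htb, hs, ht, fun r hr => ⟨?_, ?_⟩⟩
  · by_contra! h
    obtain ⟨r', hr', e⟩ := intermediate_value_Icc hr.2
      (hf'.mono (Icc_subset_Icc_left (has.trans hr.1))) ⟨h.le, huv.trans ht.ge⟩
    have : r' ≤ s := hsmax ⟨⟨has.trans (hr.1.trans hr'.1), hr'.2⟩, e⟩
    have : r = s := le_antisymm (hr'.1.trans this) hr.1
    rw [this, hs] at h
    exact lt_irrefl _ h
  · by_contra! h
    obtain ⟨r', hr', e⟩ := intermediate_value_Icc (has.trans hr.1)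
      (hf'.mono (Icc_subset_Icc_right hr.2)) ⟨ha.trans huv, h.le⟩
    have : t ≤ r' := htmin ⟨⟨hr'.1, hr'.2.trans (hr.2.trans htb)⟩, e⟩
    have : r = t := le_antisymm hr.2 (this.trans hr'.2)
    rw [this, ht] at h
    exact lt_irrefl _ h

/-! ### Rectangles, their beams, and crossings. -/

/-- The data of a closed axis-aligned rectangle. -/
structure Rect where
  left : ℝ
  right : ℝ
  bot : ℝ
  top : ℝ

namespace Rect

/-- The rectangle has positive width and height. -/
def Proper (p : Rect) : Prop := p.left < p.right ∧ p.bot < p.top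

/-- The points of the rectangle. -/
def root (p : Rect) : Set (ℝ × ℝ) := Icc p.left p.right ×ˢ Icc p.bot p.top

/-- The half-infinite strip obtained by extending the rectangle to the right. -/
def beam (p : Rect) : Set (ℝ × ℝ) := Ici p.left ×ˢ Icc p.bot p.top

/-- One rectangle is contained in another one, in coordinates. -/
def Sub (p q : Rect) : Prop :=
  q.left ≤ p.left ∧ p.right ≤ q.right ∧ q.bot ≤ p.bot ∧ p.top ≤ q.top

/-- The vertical ranges of two rectangles are disjoint. -/
def Apart (p q : Rect) : Prop := p.top < q.bot ∨ q.top < p.bot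

/-- The set `A` contains a path in the beam of `p` from its bottom line to its top line. -/
def CrossedBy (p : Rect) (A : Set (ℝ × ℝ)) : Prop :=
  ∃ (δ : ℝ → ℝ × ℝ) (a b : ℝ), a ≤ b ∧ ContinuousOn δ (Icc a b) ∧
    (∀ t ∈ Icc a b, δ t ∈ A ∩ p.beam) ∧ (δ a).2 = p.bot ∧ (δ b).2 = p.top

theorem Sub.root_subset {p q : Rect} (h : p.Sub q) : p.root ⊆ q.root := by
  obtain ⟨h1, h2, h3, h4⟩ := h
  exact prod_mono (Icc_subset_Icc h1 h2) (Icc_subset_Icc h3 h4)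

theorem Sub.beam_subset {p q : Rect} (h : p.Sub q) : p.beam ⊆ q.beam := by
  obtain ⟨h1, h2, h3, h4⟩ := h
  exact prod_mono (Ici_subset_Ici.2 h1) (Icc_subset_Icc h3 h4)

theorem Sub.trans {p q r : Rect} (h : p.Sub q) (h' : q.Sub r) : p.Sub r := by
  unfold Sub at *
  exact ⟨by linarith, by linarith, by linarith, by linarith⟩

theorem root_subset_beam (p : Rect) : p.root ⊆ p.beam :=
  prod_mono Icc_subset_Ici_self le_rfl

theorem Apart.disjoint {p q : Rect} (h : p.Apart q) : Disjoint p.beam q.beam := by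
  rw [Set.disjoint_left]
  rintro z ⟨-, h1, h2⟩ ⟨-, h3, h4⟩
  rcases h with h | h <;> linarith

theorem Apart.symm {p q : Rect} (h : p.Apart q) : q.Apart p := Or.symm h

theorem Apart.mono {p q p' q' : Rect} (h : p.Apart q) (hp : p'.Sub p) (hq : q'.Sub q) :
    p'.Apart q' := by
  obtain ⟨-, -, h1, h2⟩ := hp
  obtain ⟨-, -, h3, h4⟩ := hq
  rcases h with h | h
  · left; linarith
  · right; linarith

theorem CrossedBy.not_disjoint {p : Rect} {A : Set (ℝ × ℝ)} (h : p.CrossedBy A) :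
    ¬ Disjoint A p.beam := by
  obtain ⟨δ, a, b, hab, -, hδ, -⟩ := h
  exact Set.not_disjoint_iff.2 ⟨δ a, hδ a ⟨le_rfl, hab⟩⟩

/-- A path crossing `p` to the right of the left side of `q` crosses `q`, if the vertical range of
`q` is contained in that of `p`. -/
theorem CrossedBy.mono {p q : Rect} {A : Set (ℝ × ℝ)} (h : p.CrossedBy A)
    (hleft : ∀ z ∈ A ∩ p.beam, q.left ≤ z.1) (hq : q.bot ≤ q.top) (hbot : p.bot ≤ q.bot)
    (htop : q.top ≤ p.top) : q.CrossedBy A := by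
  obtain ⟨δ, a, b, hab, hc, hδ, h0, h1⟩ := h
  obtain ⟨s, t, has, hst, htb, es, et, hr⟩ := exists_stretch (f := fun r => (δ r).2) hab hq
    (continuous_snd.comp_continuousOn hc) (h0.trans_le hbot) (htop.trans_eq h1.symm)
  have hsub : Icc s t ⊆ Icc a b := Icc_subset_Icc has htb
  exact ⟨δ, s, t, hst, hc.mono hsub,
    fun r hr' => ⟨(hδ r (hsub hr')).1, hleft _ (hδ r (hsub hr')), hr r hr'⟩, es, et⟩

end Rect

/-! ### Probed families, colour forcing and nesting. -/

/-- The members of `F` that meet the beam of `p`. -/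
def members (F : Set (Set (ℝ × ℝ))) (p : Rect) : Set (Set (ℝ × ℝ)) :=
  {A ∈ F | ¬ Disjoint A p.beam}

/-- Distinct intersecting members of `F` get distinct colours. -/
def IsProperColouring (F : Set (Set (ℝ × ℝ))) (c : Set (ℝ × ℝ) → ℕ) : Prop :=
  ∀ A ∈ F, ∀ B ∈ F, A ≠ B → ¬ Disjoint A B → c A ≠ c B

theorem IsProperColouring.mono {F G : Set (Set (ℝ × ℝ))} {c : Set (ℝ × ℝ) → ℕ}
    (h : IsProperColouring G c) (hFG : F ⊆ G) : IsProperColouring F c :=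
  fun A hA B hB => h A (hFG hA) B (hFG hB)

/-- There are no three distinct pairwise intersecting members of `F`. -/
def TriangleFree (F : Set (Set (ℝ × ℝ))) : Prop :=
  ∀ A ∈ F, ∀ B ∈ F, ∀ D ∈ F, A ≠ B → A ≠ D → B ≠ D →
    ¬ Disjoint A B → ¬ Disjoint A D → Disjoint B D

/-- A finite triangle-free family `F` of sets from the class `C` inside the rectangle `b`,
with a finite set `P` of probes: rectangles in `b` with disjoint vertical ranges, whose roots
avoid all members of `F`, and such that the members of `F` meeting the beam of a probe cross it
and are pairwise disjoint. -/
structure IsProbedFamily (C F : Set (Set (ℝ × ℝ))) (P : Set Rect) (b : Rect) : Prop where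
  finite_family : F.Finite
  finite_probes : P.Finite
  subset_class : F ⊆ C
  triangleFree : TriangleFree F
  subset_root : ∀ A ∈ F, A ⊆ b.root
  proper : ∀ p ∈ P, p.Proper
  sub : ∀ p ∈ P, p.Sub b
  root_disjoint : ∀ p ∈ P, ∀ A ∈ F, Disjoint A p.root
  crossed : ∀ p ∈ P, ∀ A ∈ members F p, p.CrossedBy A
  independent : ∀ p ∈ P, (members F p).PairwiseDisjoint id
  apart : ∀ p ∈ P, ∀ q ∈ P, p ≠ q → p.Apart q

/-- Every proper colouring of `F` uses at least `k` colours on some probe. -/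
def Forces (F : Set (Set (ℝ × ℝ))) (P : Set Rect) (k : ℕ) : Prop :=
  ∀ c, IsProperColouring F c → ∃ p ∈ P, k ≤ (c '' members F p).ncard

/-- For every proper colouring of `F` and any set of at least `k` colours, some probe extends the
set to at least `k + 1` colours. -/
def ForcesNew (F : Set (Set (ℝ × ℝ))) (P : Set Rect) (k : ℕ) : Prop :=
  ∀ c, IsProperColouring F c → ∀ S : Set ℕ, S.Finite → k ≤ S.ncard →
    ∃ p ∈ P, k + 1 ≤ (S ∪ c '' members F p).ncard

theorem members_subset (F : Set (Set (ℝ × ℝ))) (p : Rect) : members F p ⊆ F := sep_subset _ _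

theorem members_mono {F G : Set (Set (ℝ × ℝ))} (h : F ⊆ G) (p : Rect) :
    members F p ⊆ members G p := fun _ hA => ⟨h hA.1, hA.2⟩

variable {C F : Set (Set (ℝ × ℝ))} {P : Set Rect} {b : Rect}
  {G : Rect → Set (Set (ℝ × ℝ))} {Q : Rect → Set Rect} {k : ℕ}

/-- A member meeting the beam of `p` crosses the beam of every rectangle inside `p`. -/
theorem IsProbedFamily.crossedBy_of_sub (h : IsProbedFamily C F P b) {p q : Rect} (hp : p ∈ P)
    (hq : q.Proper) (hqp : q.Sub p) {A : Set (ℝ × ℝ)} (hA : A ∈ members F p) :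
    q.CrossedBy A := by
  refine (h.crossed p hp A hA).mono ?_ hq.2.le hqp.2.2.1 hqp.2.2.2
  rintro z ⟨hz, hz1, hz2⟩
  -- The members avoid the root of `p`, so within the beam they stay to the right of it, hence to
  -- the right of `q.left`.
  by_contra! hlt
  exact Set.disjoint_left.1 (h.root_disjoint p hp A hA.1) hz
    ⟨⟨hz1, hlt.le.trans (hq.1.le.trans hqp.2.1)⟩, hz2⟩

/-- Placing a probed family in the root of each probe of a probed family. -/
theorem IsProbedFamily.compose (h : IsProbedFamily C F P b)
    (hG : ∀ p ∈ P, IsProbedFamily C (G p) (Q p) p) :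
    IsProbedFamily C (F ∪ ⋃ p ∈ P, G p) (⋃ p ∈ P, Q p) b := by
  have hFG : ∀ p ∈ P, ∀ A ∈ F, ∀ B ∈ G p, Disjoint A B := fun p hp A hA B hB =>
    (h.root_disjoint p hp A hA).mono_right ((hG p hp).subset_root B hB)
  have hGG : ∀ p ∈ P, ∀ p' ∈ P, p ≠ p' → ∀ A ∈ G p, ∀ B ∈ G p', Disjoint A B :=
    fun p hp p' hp' hne A hA B hB => (h.apart p hp p' hp' hne).disjoint.mono
      (((hG p hp).subset_root A hA).trans p.root_subset_beam)
      (((hG p' hp').subset_root B hB).trans p'.root_subset_beam)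
  have hcases : ∀ A ∈ F ∪ ⋃ p ∈ P, G p, A ∈ F ∨ ∃ p ∈ P, A ∈ G p := by
    intro A hA
    simpa using hA
  have hmem : ∀ p ∈ P, ∀ q ∈ Q p, ∀ A ∈ members (F ∪ ⋃ p ∈ P, G p) q,
      A ∈ members F p ∨ A ∈ members (G p) q := by
    intro p hp q hq A hA
    rcases hcases A hA.1 with hAF | ⟨p', hp', hAG⟩
    · exact Or.inl ⟨hAF, fun hd => hA.2 (hd.mono_right ((hG p hp).sub q hq).beam_subset)⟩
    · by_cases e : p' = p
      · subst e; exact Or.inr ⟨hAG, hA.2⟩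
      · exact absurd ((h.apart p' hp' p hp e).disjoint.mono
          (((hG p' hp').subset_root A hAG).trans p'.root_subset_beam)
          ((hG p hp).sub q hq).beam_subset) hA.2
  refine ⟨?_, ?_, ?_, ?_, ?_, ?_, ?_, ?_, ?_, ?_, ?_⟩
  · exact h.finite_family.union (h.finite_probes.biUnion fun p hp => (hG p hp).finite_family)
  · exact h.finite_probes.biUnion fun p hp => (hG p hp).finite_probes
  · exact union_subset h.subset_class (iUnion₂_subset fun p hp => (hG p hp).subset_class)
  · intro A hA B hB D hD hAB hAD hBD iAB iAD
    rcases hcases A hA with hA | ⟨p, hp, hA⟩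
    · rcases hcases B hB with hB | ⟨p, hp, hB⟩
      · rcases hcases D hD with hD | ⟨p, hp, hD⟩
        · exact h.triangleFree A hA B hB D hD hAB hAD hBD iAB iAD
        · exact absurd (hFG p hp A hA D hD) iAD
      · exact absurd (hFG p hp A hA B hB) iAB
    -- Sets from different pieces are disjoint, so a triangle would lie in a single piece.
    · have key : ∀ B ∈ F ∪ ⋃ p ∈ P, G p, ¬ Disjoint A B → B ∈ G p := by
        intro B hB iAB
        rcases hcases B hB with hB | ⟨p', hp', hB⟩
        · exact absurd (hFG p hp B hB A hA).symm iAB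
        · by_cases e : p = p'
          · rwa [e]
          · exact absurd (hGG p hp p' hp' e A hA B hB) iAB
      exact (hG p hp).triangleFree A hA B (key B hB iAB) D (key D hD iAD) hAB hAD hBD iAB iAD
  · intro A hA
    rcases hcases A hA with hA | ⟨p, hp, hA⟩
    · exact h.subset_root A hA
    · exact ((hG p hp).subset_root A hA).trans (h.sub p hp).root_subset
  · intro q hq
    obtain ⟨p, hp, hq⟩ := mem_iUnion₂.1 hq
    exact (hG p hp).proper q hq
  · intro q hq
    obtain ⟨p, hp, hq⟩ := mem_iUnion₂.1 hq
    exact ((hG p hp).sub q hq).trans (h.sub p hp)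
  · intro q hq A hA
    obtain ⟨p, hp, hq⟩ := mem_iUnion₂.1 hq
    have hqp := (hG p hp).sub q hq
    rcases hcases A hA with hA | ⟨p', hp', hA⟩
    · exact (h.root_disjoint p hp A hA).mono_right hqp.root_subset
    · by_cases e : p' = p
      · subst e; exact (hG p' hp').root_disjoint q hq A hA
      · exact (h.apart p' hp' p hp e).disjoint.mono
          (((hG p' hp').subset_root A hA).trans p'.root_subset_beam)
          (hqp.root_subset.trans p.root_subset_beam)
  · intro q hq A hA
    obtain ⟨p, hp, hq⟩ := mem_iUnion₂.1 hq
    rcases hmem p hp q hq A hA with hA | hA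
    · exact h.crossedBy_of_sub hp ((hG p hp).proper q hq) ((hG p hp).sub q hq) hA
    · exact (hG p hp).crossed q hq A hA
  · intro q hq A hA B hB hAB
    obtain ⟨p, hp, hq⟩ := mem_iUnion₂.1 hq
    rcases hmem p hp q hq A hA with hA | hA <;> rcases hmem p hp q hq B hB with hB | hB
    · exact h.independent p hp hA hB hAB
    · exact hFG p hp A hA.1 B hB.1
    · exact (hFG p hp B hB.1 A hA.1).symm
    · exact (hG p hp).independent q hq hA hB hAB
  · intro q hq q' hq' hne
    obtain ⟨p, hp, hq⟩ := mem_iUnion₂.1 hq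
    obtain ⟨p', hp', hq'⟩ := mem_iUnion₂.1 hq'
    by_cases e : p = p'
    · subst e; exact (hG p hp).apart q hq q' hq' hne
    · exact (h.apart p hp p' hp' e).mono ((hG p hp).sub q hq) ((hG p' hp').sub q' hq')

/-- The colours seen on an outer probe `p` serve as the prescribed set for the family inside `p`. An
inner probe adds a colour to them, and it still sees the outer ones because the members crossing `p`
cross every probe inside it. -/
theorem Forces.compose (h : IsProbedFamily C F P b) (hF : Forces F P k)
    (hG : ∀ p ∈ P, IsProbedFamily C (G p) (Q p) p) (hGn : ∀ p ∈ P, ForcesNew (G p) (Q p) k) :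
    Forces (F ∪ ⋃ p ∈ P, G p) (⋃ p ∈ P, Q p) (k + 1) := by
  intro c hc
  obtain ⟨p, hp, hk⟩ := hF c (hc.mono subset_union_left)
  have hGsub : G p ⊆ F ∪ ⋃ p ∈ P, G p := (subset_biUnion_of_mem hp).trans subset_union_right
  obtain ⟨q, hq, hk'⟩ := hGn p hp c (hc.mono hGsub) (c '' members F p)
    ((h.finite_family.subset (members_subset F p)).image c) hk
  refine ⟨q, mem_biUnion hp hq, hk'.trans (ncard_le_ncard ?_ ?_)⟩
  · rw [← image_union]
    refine image_mono (union_subset ?_ (members_mono hGsub q))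
    intro A hA
    exact ⟨Or.inl hA.1, (h.crossedBy_of_sub hp ((hG p hp).proper q hq)
      ((hG p hp).sub q hq) hA).not_disjoint⟩
  · exact ((h.compose hG).finite_family.subset (members_subset _ q)).image c

/-! ### Diagonals and the gain of one colour. -/

/-- Inside every rectangle `b` there is a vertical line `x = n` such that from every starting
abscissa `α < n` and in every vertical range `[u, v]` one can place a member `D` of `C` in `b`
containing a path from the line `x = α` to the line `x = n`, and having a hole `q` to the right
of this line whose beam is crossed by `D`. -/
def HasDiagonals (C : Set (Set (ℝ × ℝ))) : Prop :=
  -- The line `n` is fixed before `α`, `u`, `v`: it bounds a whole family on the right and must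
  -- serve all of its probes.
  ∀ b : Rect, b.Proper → ∃ n, b.left < n ∧ n < b.right ∧
    ∀ α u v, b.left ≤ α → α < n → u < v → ∃ D ∈ C, ∃ q : Rect,
      D ⊆ Icc α b.right ×ˢ Icc u v ∧
      (∃ (γ : ℝ → ℝ × ℝ) (s t : ℝ), s ≤ t ∧ ContinuousOn γ (Icc s t) ∧
        (∀ r ∈ Icc s t, γ r ∈ D) ∧ (γ s).1 = α ∧ n ≤ (γ t).1) ∧
      q.Proper ∧ n < q.left ∧ q.right ≤ b.right ∧ u ≤ q.bot ∧ q.top ≤ v ∧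
      Disjoint D q.root ∧ q.CrossedBy D

/-- The bottom quarter of a rectangle. -/
noncomputable def Rect.lower (p : Rect) : Rect :=
  -- A quarter, not a half, so that a gap remains below the upper half, which holds the diagonal.
  ⟨p.left, p.right, p.bot, (3 * p.bot + p.top) / 4⟩

theorem Rect.Proper.lower {p : Rect} (h : p.Proper) : p.lower.Proper :=
  ⟨h.1, by have := h.2; simp only [Rect.lower]; linarith⟩

theorem Rect.Proper.lower_sub {p : Rect} (h : p.Proper) : p.lower.Sub p :=
  ⟨le_rfl, le_rfl, le_rfl, by have := h.2; simp only [Rect.lower]; linarith⟩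

/-- `D` starts on the left side of `p`, lies in the upper half of the beam of `p` and reaches the
abscissa `n`, after which it leaves a hole `q`, in the same range, whose beam it crosses. -/
structure IsDiagonal (b : Rect) (n : ℝ) (p : Rect) (D : Set (ℝ × ℝ)) (q : Rect) : Prop where
  subset : D ⊆ Icc p.left b.right ×ˢ Icc ((p.bot + p.top) / 2) p.top
  path : ∃ (γ : ℝ → ℝ × ℝ) (s t : ℝ), s ≤ t ∧ ContinuousOn γ (Icc s t) ∧
    (∀ r ∈ Icc s t, γ r ∈ D) ∧ (γ s).1 = p.left ∧ n ≤ (γ t).1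
  proper : q.Proper
  lt_left : n < q.left
  right_le : q.right ≤ b.right
  le_bot : (p.bot + p.top) / 2 ≤ q.bot
  top_le : q.top ≤ p.top
  disjoint : Disjoint D q.root
  crossed : q.CrossedBy D

theorem IsDiagonal.subset_beam {b p q : Rect} {n : ℝ} {D : Set (ℝ × ℝ)}
    (h : IsDiagonal b n p D q) (hp : p.Proper) : D ⊆ p.beam := by
  refine h.subset.trans (prod_mono Icc_subset_Ici_self (Icc_subset_Icc_left ?_))
  linarith [hp.2]

theorem IsDiagonal.disjoint_lower {b p q : Rect} {n : ℝ} {D : Set (ℝ × ℝ)}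
    (h : IsDiagonal b n p D q) (hp : p.Proper) : Disjoint D p.lower.beam := by
  rw [Set.disjoint_left]
  rintro z hz ⟨-, -, hz2⟩
  have h1 := (h.subset hz).2.1
  have h2 := hp.2
  simp only [Rect.lower] at hz2
  linarith

theorem IsDiagonal.beam_subset {b p q : Rect} {n : ℝ} {D : Set (ℝ × ℝ)}
    (h : IsDiagonal b n p D q) (hp : p.Proper) (hn : p.left ≤ n) : q.beam ⊆ p.beam := by
  refine prod_mono (Ici_subset_Ici.2 (hn.trans h.lt_left.le)) (Icc_subset_Icc ?_ h.top_le)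
  linarith [hp.2, h.le_bot]

theorem IsDiagonal.lower_apart {b p q : Rect} {n : ℝ} {D : Set (ℝ × ℝ)}
    (h : IsDiagonal b n p D q) (hp : p.Proper) : p.lower.Apart q := by
  left
  have := h.le_bot
  have := hp.2
  simp only [Rect.lower]
  linarith

/-- A diagonal of `p` meets every set to the left of `n` that crosses `p`. -/
theorem IsDiagonal.not_disjoint {b p q : Rect} {n : ℝ} {A D : Set (ℝ × ℝ)}
    (h : IsDiagonal b n p D q) (hp : p.Proper) (hA : p.CrossedBy A) (hAn : ∀ z ∈ A, z.1 ≤ n) :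
    ¬ Disjoint D A := by
  obtain ⟨γ, s, t, hst, hγ, hγD, hs, ht⟩ := h.path
  obtain ⟨δ, a, c, hac, hδ, hδA, ha, hc⟩ := hA
  obtain ⟨r, hr, r', hr', e⟩ := exists_eq_of_paths_cross hst hac hγ hδ
    (fun r hr => hs.le.trans (hδA r hr).2.1) (fun r hr => (hAn _ (hδA r hr).1).trans ht)
    (fun r hr => ha.le.trans (h.subset_beam hp (hγD r hr)).2.1)
    (fun r hr => (h.subset_beam hp (hγD r hr)).2.2.trans hc.ge)
  exact Set.not_disjoint_iff.2 ⟨γ r, hγD r hr, e ▸ (hδA r' hr').1⟩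

section diagonals

variable {C F : Set (Set (ℝ × ℝ))} {P : Set Rect} {b : Rect} {n : ℝ}
  {D : Rect → Set (ℝ × ℝ)} {U : Rect → Rect} {k : ℕ}

theorem IsProbedFamily.fst_le (h : IsProbedFamily C F P ⟨b.left, n, b.bot, b.top⟩) :
    ∀ A ∈ F, ∀ z ∈ A, z.1 ≤ n := fun A hA _ hz => (h.subset_root A hA hz).1.2

theorem IsProbedFamily.left_le (h : IsProbedFamily C F P ⟨b.left, n, b.bot, b.top⟩) :
    ∀ p ∈ P, p.left ≤ n := fun p hp => (h.proper p hp).1.le.trans (h.sub p hp).2.1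

/-- The members of the enlarged family meeting a lower probe. -/
theorem IsProbedFamily.members_lower (h : IsProbedFamily C F P ⟨b.left, n, b.bot, b.top⟩)
    (hD : ∀ p ∈ P, IsDiagonal b n p (D p) (U p)) {p : Rect} (hp : p ∈ P) :
    members (F ∪ D '' P) p.lower = members F p := by
  apply Subset.antisymm
  · rintro A ⟨hA | ⟨p', hp', rfl⟩, hAp⟩
    · exact ⟨hA, fun hd => hAp (hd.mono_right (h.proper p hp).lower_sub.beam_subset)⟩
    · refine absurd ?_ hAp
      by_cases e : p' = p
      · subst e; exact (hD p' hp').disjoint_lower (h.proper p' hp')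
      · exact (h.apart p' hp' p hp e).disjoint.mono ((hD p' hp').subset_beam (h.proper p' hp'))
          (h.proper p hp).lower_sub.beam_subset
  · intro A hA
    exact ⟨Or.inl hA.1, (h.crossedBy_of_sub hp (h.proper p hp).lower
      (h.proper p hp).lower_sub hA).not_disjoint⟩

/-- The members of the enlarged family meeting an upper probe. -/
theorem IsProbedFamily.members_upper (h : IsProbedFamily C F P ⟨b.left, n, b.bot, b.top⟩)
    (hD : ∀ p ∈ P, IsDiagonal b n p (D p) (U p)) {p : Rect} (hp : p ∈ P) :
    members (F ∪ D '' P) (U p) = {D p} := by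
  apply Subset.antisymm
  · rintro A ⟨hA | ⟨p', hp', rfl⟩, hAp⟩
    · refine absurd (Set.disjoint_left.2 fun z hz hz' => ?_) hAp
      exact absurd (h.fst_le A hA z hz) (not_le.2 ((hD p hp).lt_left.trans_le hz'.1))
    · by_cases e : p' = p
      · rw [e]; rfl
      · exact absurd ((h.apart p' hp' p hp e).disjoint.mono
          ((hD p' hp').subset_beam (h.proper p' hp'))
          ((hD p hp).beam_subset (h.proper p hp) (h.left_le p hp))) hAp
  · rintro A rfl
    exact ⟨Or.inr ⟨p, hp, rfl⟩, (hD p hp).crossed.not_disjoint⟩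

/-- Enlarging a probed family by one diagonal per probe. -/
theorem IsProbedFamily.addDiagonals (h : IsProbedFamily C F P ⟨b.left, n, b.bot, b.top⟩)
    (hn : n ≤ b.right) (hC : ∀ p ∈ P, D p ∈ C)
    (hD : ∀ p ∈ P, IsDiagonal b n p (D p) (U p)) :
    IsProbedFamily C (F ∪ D '' P) (Rect.lower '' P ∪ U '' P) b := by
  have hbeam : ∀ p ∈ P, D p ⊆ p.beam := fun p hp => (hD p hp).subset_beam (h.proper p hp)
  have hsub : ∀ p ∈ P, p.Sub b := fun p hp =>
    (h.sub p hp).trans ⟨le_rfl, hn, le_rfl, le_rfl⟩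
  have hDD : ∀ p ∈ P, ∀ p' ∈ P, p ≠ p' → Disjoint (D p) (D p') := fun p hp p' hp' e =>
    (h.apart p hp p' hp' e).disjoint.mono (hbeam p hp) (hbeam p' hp')
  -- All neighbours of a diagonal cross its probe; these are pairwise disjoint, so no triangle
  -- contains a diagonal.
  have hnbr : ∀ p ∈ P, ∀ A ∈ F ∪ D '' P, D p ≠ A → ¬ Disjoint (D p) A → A ∈ members F p := by
    rintro p hp A (hA | ⟨p', hp', rfl⟩) hne hi
    · exact ⟨hA, fun hd => hi (hd.symm.mono_left (hbeam p hp))⟩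
    · by_cases e : p = p'
      · exact absurd (by rw [e]) hne
      · exact absurd (hDD p hp p' hp' e) hi
  have hUU : ∀ p ∈ P, p.bot ≤ (U p).bot ∧ (U p).top ≤ p.top := fun p hp =>
    ⟨by linarith [(hD p hp).le_bot, (h.proper p hp).2], (hD p hp).top_le⟩
  have hLL : ∀ p ∈ P, p.lower.bot = p.bot ∧ p.lower.top ≤ p.top := fun p hp =>
    ⟨rfl, (h.proper p hp).lower_sub.2.2.2⟩
  refine ⟨?_, ?_, ?_, ?_, ?_, ?_, ?_, ?_, ?_, ?_, ?_⟩
  · exact h.finite_family.union (h.finite_probes.image D)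
  · exact (h.finite_probes.image _).union (h.finite_probes.image _)
  · exact union_subset h.subset_class (image_subset_iff.2 hC)
  · rintro A hA B hB E hE hAB hAE hBE iAB iAE
    rcases hA with hA | ⟨p, hp, rfl⟩
    · rcases hB with hB | ⟨p, hp, rfl⟩
      · rcases hE with hE | ⟨p, hp, rfl⟩
        · exact h.triangleFree A hA B hB E hE hAB hAE hBE iAB iAE
        · by_contra iBE
          exact iAB (h.independent p hp
            (hnbr p hp A (Or.inl hA) hAE.symm fun hd => iAE hd.symm)
            (hnbr p hp B (Or.inl hB) hBE.symm fun hd => iBE hd.symm) hAB)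
      · by_contra iBE
        exact iAE (h.independent p hp
          (hnbr p hp A (Or.inl hA) hAB.symm fun hd => iAB hd.symm) (hnbr p hp E hE hBE iBE) hAE)
    · exact h.independent p hp (hnbr p hp B hB hAB iAB) (hnbr p hp E hE hAE iAE) hBE
  · rintro A (hA | ⟨p, hp, rfl⟩)
    · exact (h.subset_root A hA).trans
        (prod_mono (Icc_subset_Icc_right hn) le_rfl)
    · obtain ⟨h1, -, h3, h4⟩ := hsub p hp
      refine (hD p hp).subset.trans (prod_mono (Icc_subset_Icc_left h1) (Icc_subset_Icc ?_ h4))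
      linarith [(h.proper p hp).2]
  · rintro q (⟨p, hp, rfl⟩ | ⟨p, hp, rfl⟩)
    · exact (h.proper p hp).lower
    · exact (hD p hp).proper
  · rintro q (⟨p, hp, rfl⟩ | ⟨p, hp, rfl⟩)
    · exact (h.proper p hp).lower_sub.trans (hsub p hp)
    · obtain ⟨h1, -, h3, h4⟩ := hsub p hp
      exact ⟨h1.trans ((h.left_le p hp).trans (hD p hp).lt_left.le), (hD p hp).right_le,
        h3.trans (hUU p hp).1, (hUU p hp).2.trans h4⟩
  · rintro q (⟨p, hp, rfl⟩ | ⟨p, hp, rfl⟩) A hA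
    · by_contra hd
      have hA' : A ∈ members (F ∪ D '' P) p.lower :=
        ⟨hA, fun h' => hd (h'.mono_right (Rect.root_subset_beam _))⟩
      rw [h.members_lower hD hp] at hA'
      exact hd ((h.root_disjoint p hp A hA'.1).mono_right (h.proper p hp).lower_sub.root_subset)
    · by_contra hd
      have hA' : A ∈ members (F ∪ D '' P) (U p) :=
        ⟨hA, fun h' => hd (h'.mono_right (Rect.root_subset_beam _))⟩
      rw [h.members_upper hD hp, mem_singleton_iff] at hA'
      exact hd (hA' ▸ (hD p hp).disjoint)
  · rintro q (⟨p, hp, rfl⟩ | ⟨p, hp, rfl⟩) A hA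
    · rw [h.members_lower hD hp] at hA
      exact h.crossedBy_of_sub hp (h.proper p hp).lower (h.proper p hp).lower_sub hA
    · rw [h.members_upper hD hp, mem_singleton_iff] at hA
      exact hA ▸ (hD p hp).crossed
  · rintro q (⟨p, hp, rfl⟩ | ⟨p, hp, rfl⟩)
    · rw [h.members_lower hD hp]; exact h.independent p hp
    · rw [h.members_upper hD hp]; exact pairwiseDisjoint_singleton _ _
  · have key : ∀ p ∈ P, ∀ p' ∈ P, p ≠ p' → ∀ q q' : Rect, p.bot ≤ q.bot → q.top ≤ p.top →
        p'.bot ≤ q'.bot → q'.top ≤ p'.top → q.Apart q' := by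
      intro p hp p' hp' e q q' h1 h2 h3 h4
      rcases h.apart p hp p' hp' e with h5 | h5
      · left; linarith
      · right; linarith
    rintro q (⟨p, hp, rfl⟩ | ⟨p, hp, rfl⟩) q' (⟨p', hp', rfl⟩ | ⟨p', hp', rfl⟩) hne
    · exact key p hp p' hp' (fun e => hne (by rw [e])) _ _ (hLL p hp).1.ge (hLL p hp).2
        (hLL p' hp').1.ge (hLL p' hp').2
    · by_cases e : p = p'
      · subst e; exact (hD p hp).lower_apart (h.proper p hp)
      · exact key p hp p' hp' e _ _ (hLL p hp).1.ge (hLL p hp).2 (hUU p' hp').1 (hUU p' hp').2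
    · by_cases e : p = p'
      · subst e; exact ((hD p hp).lower_apart (h.proper p hp)).symm
      · exact key p hp p' hp' e _ _ (hUU p hp).1 (hUU p hp).2 (hLL p' hp').1.ge (hLL p' hp').2
    · exact key p hp p' hp' (fun e => hne (by rw [e])) _ _ (hUU p hp).1 (hUU p hp).2
        (hUU p' hp').1 (hUU p' hp').2

/-- Take a probe `p` on which `F` shows a set T of at least k colours. If S ∪ T has more than k
colours, the lower probe works. Otherwise S = T, and the diagonal, meeting every member counted in
T, has a colour outside S; the upper probe sees this diagonal. -/
theorem Forces.addDiagonals (h : IsProbedFamily C F P ⟨b.left, n, b.bot, b.top⟩)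
    (hF : Forces F P k) (hD : ∀ p ∈ P, IsDiagonal b n p (D p) (U p)) :
    ForcesNew (F ∪ D '' P) (Rect.lower '' P ∪ U '' P) k := by
  intro c hc S hS hkS
  obtain ⟨p, hp, hk⟩ := hF c (hc.mono subset_union_left)
  set T := c '' members F p with hT
  have hTf : T.Finite := (h.finite_family.subset (members_subset F p)).image c
  by_cases hST : k + 1 ≤ (S ∪ T).ncard
  · exact ⟨p.lower, Or.inl ⟨p, hp, rfl⟩, by rwa [h.members_lower hD hp]⟩
  · have hSe : S = S ∪ T :=
      eq_of_subset_of_ncard_le subset_union_left (by omega) (hS.union hTf)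
    have hTe : T = S ∪ T :=
      eq_of_subset_of_ncard_le subset_union_right (by omega) (hS.union hTf)
    have hnew : c (D p) ∉ S := by
      rw [hSe, ← hTe]
      rintro ⟨A, hA, e⟩
      -- Family and diagonals are merged as sets, so a coincidence must be excluded: `A` meets the
      -- lower beam, `D p` does not.
      have hAn : A ≠ D p := by
        rintro rfl
        rw [← h.members_lower hD hp] at hA
        exact hA.2 ((hD p hp).disjoint_lower (h.proper p hp))
      exact hc A (Or.inl hA.1) (D p) (Or.inr ⟨p, hp, rfl⟩) hAn
        (fun hd => (hD p hp).not_disjoint (h.proper p hp) (h.crossed p hp A hA)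
          (h.fst_le A hA.1) hd.symm) e
    refine ⟨U p, Or.inr ⟨p, hp, rfl⟩, ?_⟩
    rw [h.members_upper hD hp, image_singleton, union_singleton, ncard_insert_of_notMem hnew hS]
    omega

end diagonals

/-! ### Induction on the number of colours. -/

/-- A class of sets with diagonals contains, in every rectangle, probed families forcing any
number of colours on a probe. -/
theorem HasDiagonals.exists_forces {C : Set (Set (ℝ × ℝ))} (hC : HasDiagonals C) (k : ℕ) :
    ∀ b : Rect, b.Proper → ∃ F P, IsProbedFamily C F P b ∧ Forces F P k := by
  induction k with
  | zero =>
    intro b hb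
    -- Zero colours are forced by the empty family with `b` itself as the only probe.
    refine ⟨∅, {b}, ?_, fun c _ => ⟨b, rfl, Nat.zero_le _⟩⟩
    refine ⟨finite_empty, finite_singleton b, empty_subset _, by simp [TriangleFree], by simp,
      by simpa using hb, by simp [Rect.Sub], by simp, by simp [members], by simp [members], ?_⟩
    rintro p rfl q rfl h
    exact absurd rfl h
  | succ k ih =>
    have hstep : ∀ b : Rect, b.Proper → ∃ F P, IsProbedFamily C F P b ∧ ForcesNew F P k := by
      intro b hb
      obtain ⟨n, hn, hn', hdiag⟩ := hC b hb
      obtain ⟨F, P, hF, hk⟩ := ih ⟨b.left, n, b.bot, b.top⟩ ⟨hn, hb.2⟩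
      -- Diagonals are chosen for all rectangles; the values outside `P` are arbitrary.
      have hex : ∀ p : Rect, ∃ D q, p ∈ P → D ∈ C ∧ IsDiagonal b n p D q := by
        intro p
        by_cases hp : p ∈ P
        · obtain ⟨D, hDC, q, h1, h2, h3, h4, h5, h6, h7, h8, h9⟩ :=
            hdiag p.left ((p.bot + p.top) / 2) p.top (hF.sub p hp).1
              ((hF.proper p hp).1.trans_le (hF.sub p hp).2.1) (by linarith [(hF.proper p hp).2])
          exact ⟨D, q, fun _ => ⟨hDC, h1, h2, h3, h4, h5, h6, h7, h8, h9⟩⟩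
        · exact ⟨∅, p, fun h => absurd h hp⟩
      choose D U hDU using hex
      exact ⟨_, _, hF.addDiagonals hn'.le (fun p hp => (hDU p hp).1) (fun p hp => (hDU p hp).2),
        Forces.addDiagonals hF hk fun p hp => (hDU p hp).2⟩
    intro b hb
    obtain ⟨F, P, hF, hk⟩ := ih b hb
    have hex : ∀ p : Rect, ∃ G Q, p ∈ P → IsProbedFamily C G Q p ∧ ForcesNew G Q k := by
      intro p
      by_cases hp : p ∈ P
      · obtain ⟨G, Q, hG⟩ := hstep p (hF.proper p hp)
        exact ⟨G, Q, fun _ => hG⟩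
      · exact ⟨∅, ∅, fun h => absurd h hp⟩
    choose G Q hGQ using hex
    exact ⟨_, _, hF.compose fun p hp => (hGQ p hp).1,
      Forces.compose hF hk (fun p hp => (hGQ p hp).1) fun p hp => (hGQ p hp).2⟩

/-! ### Copies of a set with a hole serve as diagonals. -/

theorem IsPathConnected.exists_continuous_path {X : Set (ℝ × ℝ)} (hX : IsPathConnected X)
    {x y : ℝ × ℝ} (hx : x ∈ X) (hy : y ∈ X) :
    ∃ γ : ℝ → ℝ × ℝ, Continuous γ ∧ (∀ r, γ r ∈ X) ∧ γ 0 = x ∧ γ 1 = y := by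
  have h := hX.joinedIn x hx y hy
  refine ⟨h.somePath.extend, h.somePath.continuous_extend, fun r => ?_, by simp, by simp⟩
  exact h.somePath_mem (projIcc 0 1 zero_le_one r)

/-- The image of a rectangle under scaling and translation. -/
def Rect.scale (q : Rect) (s t a b : ℝ) : Rect :=
  ⟨s * q.left + a, s * q.right + a, t * q.bot + b, t * q.top + b⟩

theorem Rect.CrossedBy.scale {q : Rect} {X : Set (ℝ × ℝ)} (h : q.CrossedBy X) {s t : ℝ}
    (hs : 0 < s) (ht : 0 < t) (a b : ℝ) :
    (q.scale s t a b).CrossedBy ((fun z : ℝ × ℝ => (s * z.1 + a, t * z.2 + b)) '' X) := by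
  obtain ⟨δ, i, j, hij, hδ, hX, hi, hj⟩ := h
  refine ⟨fun r => (s * (δ r).1 + a, t * (δ r).2 + b), i, j, hij, by fun_prop, fun r hr => ?_,
    by simp only [hi, Rect.scale], by simp only [hj, Rect.scale]⟩
  obtain ⟨h1, h2, h3, h4⟩ := hX r hr
  have h2 : q.left ≤ (δ r).1 := h2
  refine ⟨mem_image_of_mem _ h1, ?_, ?_, ?_⟩
  · change s * q.left + a ≤ s * (δ r).1 + a
    gcongr
  · change t * q.bot + b ≤ t * (δ r).2 + b
    gcongr
  · change t * (δ r).2 + b ≤ t * q.top + b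
    gcongr

theorem Rect.disjoint_scale {q : Rect} {X : Set (ℝ × ℝ)} (h : Disjoint X q.root) {s t : ℝ}
    (hs : 0 < s) (ht : 0 < t) (a b : ℝ) :
    Disjoint ((fun z : ℝ × ℝ => (s * z.1 + a, t * z.2 + b)) '' X) (q.scale s t a b).root := by
  rw [Set.disjoint_left] at h ⊢
  rintro _ ⟨z, hz, rfl⟩ ⟨⟨h1, h2⟩, h3, h4⟩
  simp only [Rect.scale, add_le_add_iff_right] at h1 h2 h3 h4
  exact h hz ⟨⟨le_of_mul_le_mul_left h1 hs, le_of_mul_le_mul_left h2 hs⟩,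
    le_of_mul_le_mul_left h3 ht, le_of_mul_le_mul_left h4 ht⟩

/-- A path-connected set with a hole whose beam to the right is crossed by the set has copies
serving as diagonals. -/
theorem hasDiagonals_of_hole {X : Set (ℝ × ℝ)} (hX : IsPathConnected X) {B q : Rect}
    (hB : X ⊆ B.root) {l r : ℝ × ℝ} (hl : l ∈ X) (hlB : l.1 = B.left) (hr : r ∈ X)
    (hrB : r.1 = B.right) (hq : q.Proper) (hqB : q.Sub B) (hlq : B.left < q.left)
    (hdisj : Disjoint X q.root) (hcross : q.CrossedBy X) :
    HasDiagonals {Y | IsTransformedCopy X Y} := by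
  intro b hb
  obtain ⟨hq1, hq2⟩ := hq
  obtain ⟨-, hqB2, hqB3, hqB4⟩ := hqB
  obtain ⟨hb1, hb2⟩ := hb
  have hw : 0 < B.right - B.left := by linarith
  have hh : 0 < B.top - B.bot := by linarith
  -- The abscissa `m`, strictly between the left side of the box and the hole, will be sent to `n`,
  -- which puts the hole beyond `n`.
  set m := (B.left + q.left) / 2 with hm
  have hm1 : 0 < m - B.left := by linarith
  have hm2 : m < q.left := by linarith
  set ρ := (m - B.left) / (B.right - B.left) with hρ
  have hρ0 : 0 < ρ := div_pos hm1 hw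
  have hρ1 : ρ < 1 := (div_lt_one hw).2 (by linarith)
  -- `n` divides the width of `b` as `m` divides that of `B`: a copy starting at `b.left` would end
  -- exactly at `b.right`, and one starting further right ends no later.
  refine ⟨b.left + ρ * (b.right - b.left), by nlinarith, by nlinarith, ?_⟩
  intro α u v hα hαn huv
  set n := b.left + ρ * (b.right - b.left) with hn
  set s := (n - α) / (m - B.left) with hs
  have hs0 : 0 < s := div_pos (by linarith) hm1
  have hsm : s * (m - B.left) = n - α := div_mul_cancel₀ _ hm1.ne'
  set t := (v - u) / (B.top - B.bot) with ht
  have ht0 : 0 < t := div_pos (by linarith) hh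
  have hth : t * (B.top - B.bot) = v - u := div_mul_cancel₀ _ hh.ne'
  have hsw : s * (B.right - B.left) ≤ b.right - α := by
    have h1 : ρ * (B.right - B.left) = m - B.left := div_mul_cancel₀ _ hw.ne'
    have h2 : ρ * (s * (B.right - B.left)) = n - α := by
      rw [← hsm, ← h1]; ring
    have h3 : n - α ≤ ρ * (b.right - α) := by nlinarith
    exact le_of_mul_le_mul_left (h2.trans_le h3) hρ0
  have hx : ∀ x, s * x + (α - s * B.left) = α + s * (x - B.left) := fun x => by ring
  have hy : ∀ y, t * y + (u - t * B.bot) = u + t * (y - B.bot) := fun y => by ring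
  refine ⟨_, ⟨s, t, α - s * B.left, u - t * B.bot, hs0, ht0, rfl⟩,
    q.scale s t (α - s * B.left) (u - t * B.bot), ?_, ?_, ?_, ?_, ?_, ?_, ?_,
    Rect.disjoint_scale hdisj hs0 ht0 _ _, hcross.scale hs0 ht0 _ _⟩
  · rintro _ ⟨z, hz, rfl⟩
    obtain ⟨⟨h1, h2⟩, h3, h4⟩ := hB hz
    refine ⟨⟨?_, ?_⟩, ?_, ?_⟩ <;> dsimp only
    · rw [hx]; linarith [mul_nonneg hs0.le (sub_nonneg.2 h1)]
    · rw [hx]; linarith [mul_le_mul_of_nonneg_left (sub_le_sub_right h2 B.left) hs0.le]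
    · rw [hy]; linarith [mul_nonneg ht0.le (sub_nonneg.2 h3)]
    · rw [hy]; linarith [mul_le_mul_of_nonneg_left (sub_le_sub_right h4 B.bot) ht0.le]
  · obtain ⟨γ, hγ, hγX, h0, h1⟩ := hX.exists_continuous_path hl hr
    refine ⟨fun r => (s * (γ r).1 + (α - s * B.left), t * (γ r).2 + (u - t * B.bot)), 0, 1,
      zero_le_one, by fun_prop, fun r _ => mem_image_of_mem _ (hγX r), ?_, ?_⟩
    · simp only [h0, hlB]; ring
    · simp only [h1, hrB]
      rw [hx]
      linarith [mul_le_mul_of_nonneg_left (show m - B.left ≤ B.right - B.left by linarith) hs0.le]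
  · simp only [Rect.Proper, Rect.scale]
    constructor <;> gcongr
  · simp only [Rect.scale, hx]
    linarith [mul_lt_mul_of_pos_left (show m - B.left < q.left - B.left by linarith) hs0]
  · simp only [Rect.scale, hx]
    linarith [mul_le_mul_of_nonneg_left (sub_le_sub_right hqB2 B.left) hs0.le]
  · simp only [Rect.scale, hy]
    linarith [mul_nonneg ht0.le (sub_nonneg.2 hqB3)]
  · simp only [Rect.scale, hy]
    linarith [mul_le_mul_of_nonneg_left (sub_le_sub_right hqB4 B.bot) ht0.le]

/-! ### Finding a hole, up to reflection. -/

/-- The reflection of the plane in the vertical axis. -/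
def reflect (z : ℝ × ℝ) : ℝ × ℝ := (-z.1, z.2)

theorem reflect_reflect (z : ℝ × ℝ) : reflect (reflect z) = z := by simp [reflect]

theorem reflect_injective : Function.Injective reflect :=
  Function.LeftInverse.injective reflect_reflect

theorem continuous_reflect : Continuous reflect := by unfold reflect; fun_prop

/-- A set that is not a rectangle has a hole in its bounding box, and either the set or its
reflection crosses the beam of its hole to the right. -/
theorem exists_hole {X : Set (ℝ × ℝ)} (hconn : IsPathConnected X) (hcomp : IsCompact X)
    (hrect : ¬ IsAxisAlignedRectangle X) :
    ∃ B q : Rect, X ⊆ B.root ∧ (∃ l ∈ X, l.1 = B.left) ∧ (∃ r ∈ X, r.1 = B.right) ∧ q.Proper ∧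
      q.Sub B ∧ B.left < q.left ∧ q.right < B.right ∧ Disjoint X q.root ∧
      (q.CrossedBy X ∨ (Rect.mk (-q.right) (-q.left) q.bot q.top).CrossedBy (reflect '' X)) := by
  have hne := hconn.nonempty
  obtain ⟨l, hl, hlmin⟩ := hcomp.exists_isMinOn hne continuous_fst.continuousOn
  obtain ⟨r, hr, hrmax⟩ := hcomp.exists_isMaxOn hne continuous_fst.continuousOn
  obtain ⟨o, ho, homin⟩ := hcomp.exists_isMinOn hne continuous_snd.continuousOn
  obtain ⟨t, ht, htmax⟩ := hcomp.exists_isMaxOn hne continuous_snd.continuousOn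
  have hsub : X ⊆ Icc l.1 r.1 ×ˢ Icc o.2 t.2 := fun z hz =>
    ⟨⟨hlmin hz, hrmax hz⟩, homin hz, htmax hz⟩
  obtain ⟨z, ⟨⟨hz1, hz2⟩, hz3, hz4⟩, hzX⟩ : ∃ z ∈ Icc l.1 r.1 ×ˢ Icc o.2 t.2, z ∉ X := by
    by_contra! h
    exact hrect ⟨l.1, r.1, o.2, t.2, hlmin hr, homin ht, hsub.antisymm h⟩
  -- In a degenerate bounding box connectedness would make `X` fill the segment, including `z`.
  have hlr : l.1 < r.1 := by
    refine lt_of_le_of_ne (hlmin hr) fun e => hzX ?_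
    obtain ⟨w, hw, hwz⟩ := hconn.isConnected.isPreconnected.intermediate_value ho ht
      continuous_snd.continuousOn ⟨hz3, hz4⟩
    have h1 : l.1 ≤ w.1 := hlmin hw
    have h2 : w.1 ≤ r.1 := hrmax hw
    have : w = z := Prod.ext (by linarith) hwz
    exact this ▸ hw
  have hot : o.2 < t.2 := by
    refine lt_of_le_of_ne (homin ht) fun e => hzX ?_
    obtain ⟨w, hw, hwz⟩ := hconn.isConnected.isPreconnected.intermediate_value hl hr
      continuous_fst.continuousOn ⟨hz1, hz2⟩
    have h1 : o.2 ≤ w.2 := homin hw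
    have h2 : w.2 ≤ t.2 := htmax hw
    have : w = z := Prod.ext hwz (by linarith)
    exact this ▸ hw
  -- The missing point may lie on the boundary of the box, so the hole is cut out of the interior of
  -- the box near `z` and need not contain `z`. Strict margins on both sides keep the reflected case
  -- symmetric.
  obtain ⟨ε, hε, hball⟩ := Metric.isOpen_iff.1 hcomp.isClosed.isOpen_compl z hzX
  rw [← ball_prod_same, Real.ball_eq_Ioo, Real.ball_eq_Ioo] at hball
  obtain ⟨e₁, he₁, he₁'⟩ := exists_between
    (show max l.1 (z.1 - ε) < min r.1 (z.1 + ε) from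
      max_lt (lt_min hlr (by linarith)) (lt_min (by linarith) (by linarith)))
  obtain ⟨e₂, he₂, he₂'⟩ := exists_between he₁'
  obtain ⟨c, hc, hc'⟩ := exists_between
    (show max o.2 (z.2 - ε) < min t.2 (z.2 + ε) from
      max_lt (lt_min hot (by linarith)) (lt_min (by linarith) (by linarith)))
  obtain ⟨d, hd, hd'⟩ := exists_between hc'
  rw [max_lt_iff] at he₁ hc
  rw [lt_min_iff] at he₂' hd'
  have hdisj : Disjoint X (Rect.mk e₁ e₂ c d).root := by
    rw [Set.disjoint_right]
    rintro w ⟨⟨h1, h2⟩, h3, h4⟩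
    exact hball ⟨⟨he₁.2.trans_le h1, h2.trans_lt he₂'.2⟩, hc.2.trans_le h3, h4.trans_lt hd'.2⟩
  refine ⟨⟨l.1, r.1, o.2, t.2⟩, ⟨e₁, e₂, c, d⟩, hsub, ⟨l, hl, rfl⟩, ⟨r, hr, rfl⟩, ⟨he₂, hd⟩,
    ⟨he₁.1.le, he₂'.1.le, hc.1.le, hd'.1.le⟩, he₁.1, he₂'.1, hdisj, ?_⟩
  obtain ⟨γ, hγ, hγX, h0, h1⟩ := hconn.exists_continuous_path ho ht
  obtain ⟨a, b, -, hab, -, ha, hb, hr'⟩ := exists_stretch (f := fun r => (γ r).2) zero_le_one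
    hd.le (by fun_prop) (show (γ 0).2 ≤ c by rw [h0]; exact hc.1.le)
    (show d ≤ (γ 1).2 by rw [h1]; exact hd'.1.le)
  -- Within the height range of the hole the path avoids the abscissas `[e₁, e₂]`, so by the
  -- intermediate value theorem it stays on the side where it starts.
  have hout : ∀ i ∈ Icc a b, (γ i).1 ∉ Icc e₁ e₂ := fun i hi h =>
    Set.disjoint_left.1 hdisj (hγX i) ⟨h, hr' i hi⟩
  have hivt : ∀ i ∈ Icc a b, uIcc (γ a).1 (γ i).1 ⊆ (fun j => (γ j).1) '' Icc a b := by
    intro i hi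
    refine (intermediate_value_uIcc (f := fun j => (γ j).1) (by fun_prop)).trans (image_mono ?_)
    rw [uIcc_of_le hi.1]
    exact Icc_subset_Icc_right hi.2
  rcases lt_or_ge (γ a).1 e₁ with h | h
  · right
    refine ⟨fun i => reflect (γ i), a, b, hab, (continuous_reflect.comp hγ).continuousOn,
      fun i hi => ⟨mem_image_of_mem _ (hγX i), ?_, hr' i hi⟩, ha, hb⟩
    change -e₂ ≤ -(γ i).1
    by_contra! h'
    obtain ⟨j, hj, hje⟩ := hivt i hi (mem_uIcc_of_le h.le (show e₁ ≤ (γ i).1 by linarith))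
    exact hout j hj ⟨hje.ge, hje.le.trans he₂.le⟩
  · left
    refine ⟨γ, a, b, hab, hγ.continuousOn, fun i hi => ⟨hγX i, ?_, hr' i hi⟩, ha, hb⟩
    change e₁ ≤ (γ i).1
    by_contra! h'
    obtain ⟨j, hj, hje⟩ := hivt i hi (mem_uIcc_of_ge h'.le h)
    exact hout j hj ⟨hje.ge, hje.le.trans he₂.le⟩

/-! ### From forced colours to the chromatic number. -/

/-- A finite triangle-free family of copies of `X` needing more than `k` colours. -/
def HasFamily (X : Set (ℝ × ℝ)) (k : ℕ) : Prop :=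
  ∃ F : Set (Set (ℝ × ℝ)), F.Finite ∧ (∀ Y ∈ F, IsTransformedCopy X Y) ∧ TriangleFree F ∧
    ∀ c, IsProperColouring F c → k < (c '' F).ncard

theorem HasDiagonals.hasFamily {X : Set (ℝ × ℝ)}
    (h : HasDiagonals {Y | IsTransformedCopy X Y}) (k : ℕ) : HasFamily X k := by
  -- Forcing `k + 1` colours on a probe gives strictly more than `k` overall.
  obtain ⟨F, P, hF, hk⟩ := h.exists_forces (k + 1) ⟨0, 1, 0, 1⟩ ⟨one_pos, one_pos⟩
  refine ⟨F, hF.finite_family, hF.subset_class, hF.triangleFree, fun c hc => ?_⟩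
  obtain ⟨p, -, hp⟩ := hk c hc
  exact hp.trans (ncard_le_ncard (image_mono (members_subset F p)) (hF.finite_family.image c))

/-- Reflection is not itself an allowed transformation, but conjugating by it only changes the sign
of the horizontal translation and keeps both scale factors positive. -/
theorem IsTransformedCopy.reflect {X Y : Set (ℝ × ℝ)} (h : IsTransformedCopy (reflect '' X) Y) :
    IsTransformedCopy X (reflect '' Y) := by
  obtain ⟨s, t, a, b, hs, ht, rfl⟩ := h
  refine ⟨s, t, -a, b, hs, ht, ?_⟩
  rw [image_image, image_image]
  refine image_congr fun z _ => ?_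
  simp only [_root_.reflect, Prod.mk.injEq, and_true]
  ring

theorem HasFamily.of_reflect {X : Set (ℝ × ℝ)} {k : ℕ} (h : HasFamily (reflect '' X) k) :
    HasFamily X k := by
  obtain ⟨F, hfin, hcopy, htri, hcol⟩ := h
  have hinj : Function.Injective (image reflect) := reflect_injective.image_injective
  refine ⟨image reflect '' F, hfin.image _, ?_, ?_, fun c hc => ?_⟩
  · rintro _ ⟨Y, hY, rfl⟩
    exact (hcopy Y hY).reflect
  · rintro _ ⟨A, hA, rfl⟩ _ ⟨B, hB, rfl⟩ _ ⟨D, hD, rfl⟩ hAB hAD hBD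
    simp only [disjoint_image_iff reflect_injective]
    exact htri A hA B hB D hD (ne_of_apply_ne _ hAB) (ne_of_apply_ne _ hAD)
      (ne_of_apply_ne _ hBD)
  · rw [image_image]
    refine hcol (fun Y => c (reflect '' Y)) fun A hA B hB hAB hi => ?_
    exact hc _ ⟨A, hA, rfl⟩ _ ⟨B, hB, rfl⟩ (hinj.ne hAB)
      (by rwa [disjoint_image_iff reflect_injective])

theorem hasFamily_of_not_rectangle {X : Set (ℝ × ℝ)} (hconn : IsPathConnected X)
    (hcomp : IsCompact X) (hrect : ¬ IsAxisAlignedRectangle X) (k : ℕ) : HasFamily X k := by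
  obtain ⟨B, q, hB, ⟨l, hl, hlB⟩, ⟨r, hr, hrB⟩, hq, hqB, hlq, hqr, hdisj, h | h⟩ :=
    exists_hole hconn hcomp hrect
  · exact (hasDiagonals_of_hole hconn hB hl hlB hr hrB hq hqB hlq hdisj h).hasFamily k
  · refine (HasDiagonals.hasFamily ?_ k).of_reflect
    refine hasDiagonals_of_hole (hconn.image continuous_reflect)
      (B := ⟨-B.right, -B.left, B.bot, B.top⟩) (q := ⟨-q.right, -q.left, q.bot, q.top⟩)
      (l := reflect r) (r := reflect l) ?_ (mem_image_of_mem _ hr) (congrArg _ hrB)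
      (mem_image_of_mem _ hl) (congrArg _ hlB) ⟨neg_lt_neg hq.1, hq.2⟩
      ⟨neg_le_neg hqr.le, neg_le_neg hlq.le, hqB.2.2⟩ (neg_lt_neg hqr) ?_ h
    · rintro _ ⟨z, hz, rfl⟩
      obtain ⟨⟨h1, h2⟩, h3⟩ := hB hz
      exact ⟨⟨neg_le_neg h2, neg_le_neg h1⟩, h3⟩
    · rw [Set.disjoint_left] at hdisj ⊢
      rintro _ ⟨z, hz, rfl⟩ ⟨⟨h1, h2⟩, h3⟩
      exact hdisj hz ⟨⟨neg_le_neg_iff.1 h2, neg_le_neg_iff.1 h1⟩, h3⟩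

theorem TriangleFree.cliqueFree {F : Set (Set (ℝ × ℝ))} (h : TriangleFree F) :
    (intersectionGraph F).CliqueFree 3 := by
  classical
  intro s hs
  obtain ⟨A, B, D, hAB, hAD, hBD, -⟩ := SimpleGraph.is3Clique_iff.1 hs
  have key : ∀ {U V : F}, (intersectionGraph F).Adj U V →
      (U : Set (ℝ × ℝ)) ≠ V ∧ ¬ Disjoint (U : Set (ℝ × ℝ)) V := fun h =>
    ⟨fun e => h.1 (Subtype.ext e), Set.not_disjoint_iff_nonempty_inter.2 h.2⟩
  exact (key hBD).2 (h A A.2 B B.2 D D.2 (key hAB).1 (key hAD).1 (key hBD).1 (key hAB).2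
    (key hAD).2)

theorem not_colorable_of_forall_colouring {F : Set (Set (ℝ × ℝ))} {k : ℕ}
    (h : ∀ c, IsProperColouring F c → k < (c '' F).ncard) :
    ¬ (intersectionGraph F).Colorable k := by
  classical
  rintro ⟨K⟩
  -- The default colour 0 outside `F` is never counted, as only the image of `F` matters.
  set c : Set (ℝ × ℝ) → ℕ := fun A => if hA : A ∈ F then (K ⟨A, hA⟩ : ℕ) else 0 with hc
  have hval : ∀ A (hA : A ∈ F), c A = K ⟨A, hA⟩ := fun A hA => dif_pos hA
  refine (h c ?_).not_ge ?_
  · intro A hA B hB hne hi e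
    rw [hval A hA, hval B hB] at e
    exact K.valid (v := ⟨A, hA⟩) (w := ⟨B, hB⟩) ⟨fun e => hne (congrArg Subtype.val e),
      Set.not_disjoint_iff_nonempty_inter.1 hi⟩ (Fin.ext e)
  · calc (c '' F).ncard ≤ (Iio k).ncard := by
          refine ncard_le_ncard ?_ (finite_Iio k)
          rintro _ ⟨A, hA, rfl⟩
          rw [hval A hA]
          exact (K ⟨A, hA⟩).2
      _ = k := by simp [ncard_eq_toFinset_card']

theorem theorem1 (X : Set (ℝ × ℝ)) (hconn : IsPathConnected X) (hcomp : IsCompact X)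
    (hrect : ¬ IsAxisAlignedRectangle X) (k : ℕ) (hk : 1 ≤ k) :
    ∃ F : Set (Set (ℝ × ℝ)), F.Finite ∧ (∀ Y ∈ F, IsTransformedCopy X Y) ∧
      (intersectionGraph F).CliqueFree 3 ∧
      (k : ℕ∞) < (intersectionGraph F).chromaticNumber := by
  obtain ⟨F, hfin, hcopy, htri, hcol⟩ := hasFamily_of_not_rectangle hconn hcomp hrect k
  refine ⟨F, hfin, hcopy, htri.cliqueFree, lt_of_not_ge fun h => ?_⟩
  exact not_colorable_of_forall_colouring hcol (SimpleGraph.chromaticNumber_le_iff_colorable.1 h)
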